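/- Let $X$ be a compact, second countable, Hausdorff, totally disconnected space and let $R$ be an equivalence relation on $X$ (identified with its graph in $X\times X$) such that $R=\bigcup_n R_n$, where $R_0\subset R_1\subset\cdots$ are proper equivalence relations, i.e. each $R_n$ is closed in $X\times X$ and the quotient map $X\to X/R_n$ is a local homeomorphism; thus $(X,R)$ is an AF equivalence relation. Equip $R$ with the inductive limit topology: $U\subset R$ is open iff $U\cap R_n$ is open in $R_n\subset X\times X$ for all $n$. Let $A$ be a locally compact Hausdorff group. A cocycle is a map $c:R\to A$ with $c(x,y)c(y,z)=c(x,z)$; two cocycles $c,c'$ are continuously cohomologous if $c'(x,y)=b(x)c(x,y)b(y)^{-1}$ on $R$ for some continuous $b:X\to A$. A Bratteli diagram consists of vertex sets $V(n)$ ($n\ge 0$) and sets $E(n)$ ($n\ge 1$) of edges running from a vertex of $V(n-1)$ to a vertex of $V(n)$, such that every vertex emits finitely many, but at least one, edges. Its path space $\underline X$ is the set of infinite paths $x=x_1x_2\ldots$ ($x_n\in E(n)$) starting at level $0$, with the topology generated by the cylinder sets. Its tail equivalence relation is $\underline R=\bigcup_N\underline R_N$, where $(x,y)\in\underline R_N$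 iff $x_n=y_n$ for all $n>N$; it has the inductive limit topology of the $\underline R_N$. A cocycle $c:\underline R\to A$ is a quasi-product cocycle if there are maps $f_n:E(n)\to A$ with $c(x,y)=\lim_n f_1(x_1)\cdots f_n(x_n)f_n(y_n)^{-1}\cdots f_1(y_1)^{-1}$ for all $(x,y)\in\underline R$ (the sequence is eventually constant). 1. There exist a Bratteli diagram with path space and tail equivalence relation $(\underline X,\underline R)$ and a homeomorphism $\varphi:X\to\underline X$ such that $\varphi\times\varphi$ maps $R$ onto $\underline R$ and is a homeomorphism for the inductive limit topologies. 2. If $c:R\to A$ is a continuous cocycle that takes finitely many values on each $R_n$, then the Bratteli diagram and $\varphi$ in (1) can be chosen such that the cocycle $c\circ(\varphi\times\varphi)^{-1}$ on $\underline R$ is a quasi-product cocycle. 3. If $A$ is metrizable, every continuous cocycle $c:R\to A$ is continuously cohomologous to a continuous cocycle that takes finitely many values on each $R_n$. Consequently, if $A$ is metrizable, every continuous cocycle $c:R\to A$ is continuously cohomologous to a continuous cocycle $c'$ for which there are a Bratteli diagram and a homeomorphism $\varphi$ as in (1) such that $c'\circ(\varphi\times\varphi)^{-1}$ is a quasi-product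 cocycle. -/

import Mathlib

universe u v

namespace AFRel

/-! ### Equivalence relations, proper relations, exhaustions -/

/-- The graph `{(x, y) : x R y} ⊆ X × X` of an equivalence relation. -/
abbrev Graph {X : Type u} (R : Setoid X) : Type u := {p : X × X // R p.1 p.2}

/-- `R` is proper: its graph is closed in `X × X` and the quotient map `X → X / R`
(quotient topology) is a local homeomorphism. -/
structure IsProper {X : Type u} [TopologicalSpace X] (R : Setoid X) : Prop where
  isClosed_graph : IsClosed {p : X × X | R p.1 p.2}
  isLocalHomeomorph_mk : IsLocalHomeomorph (Quotient.mk R)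

/-- An increasing sequence of equivalence relations with union `R`. -/
structure Exhaustion {X : Type u} (R : Setoid X) where
  rel : ℕ → Setoid X
  mono : Monotone rel
  union : ∀ x y, R x y ↔ ∃ n, rel n x y

namespace Exhaustion

variable {X : Type u} {R : Setoid X}

/-- The inclusion `R_n → R`. -/
def incl (𝓔 : Exhaustion R) (n : ℕ) (p : Graph (𝓔.rel n)) : Graph R :=
  ⟨p.1, (𝓔.union _ _).2 ⟨n, p.2⟩⟩

/-- The inductive limit topology on `R = ⋃ R_n`, where each `R_n` has the topology
of a subspace of `X × X`: a set is open iff its trace on every `R_n` is open. -/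
abbrev limTopology [TopologicalSpace X] (𝓔 : Exhaustion R) : TopologicalSpace (Graph R) :=
  ⨆ n, TopologicalSpace.coinduced (𝓔.incl n) instTopologicalSpaceSubtype

/-- `R`, as the union of the given sequence, is an AF equivalence relation: the relations `R_n` are
proper and `X` is totally disconnected. -/
structure IsAF [TopologicalSpace X] (𝓔 : Exhaustion R) : Prop where
  proper : ∀ n, IsProper (𝓔.rel n)
  totallyDisconnected : TotallyDisconnectedSpace X

end Exhaustion

/-! ### Cocycles -/

/-- `c : R → A` is a cocycle: `c(x,y) c(y,z) = c(x,z)`. -/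
def IsCocycle {X : Type u} (R : Setoid X) {A : Type v} [Group A] (c : Graph R → A) : Prop :=
  ∀ (x y z : X) (hxy : R x y) (hyz : R y z),
    c ⟨(x, y), hxy⟩ * c ⟨(y, z), hyz⟩ = c ⟨(x, z), R.trans hxy hyz⟩

/-- Continuous cocycles, with respect to the inductive limit topology of `R`. -/
structure IsContCocycle {X : Type u} [TopologicalSpace X] {R : Setoid X} (𝓔 : Exhaustion R)
    {A : Type v} [Group A] [TopologicalSpace A] (c : Graph R → A) : Prop where
  cocycle : IsCocycle R c
  continuous : @Continuous _ _ 𝓔.limTopology _ c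

/-- `c` takes finitely many values on each `R_n`. -/
def FinitelyValuedOnEach {X : Type u} {R : Setoid X} (𝓔 : Exhaustion R)
    {A : Type v} (c : Graph R → A) : Prop :=
  ∀ n, (Set.range fun p : Graph (𝓔.rel n) => c (𝓔.incl n p)).Finite

/-- `c` and `c'` are continuously cohomologous: `c'(x,y) = b(x) c(x,y) b(y)⁻¹` for some
continuous `b : X → A`. -/
def ContCohomologous {X : Type u} [TopologicalSpace X] {R : Setoid X}
    {A : Type v} [Group A] [TopologicalSpace A] (c c' : Graph R → A) : Prop :=
  ∃ b : X → A, Continuous b ∧ ∀ p : Graph R, c' p = b p.1.1 * c p * (b p.1.2)⁻¹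

/-! ### Isomorphisms -/

/-- `φ × φ` carries `R` onto `S`. -/
def Carries {X Y : Type u} (R : Setoid X) (S : Setoid Y) (φ : X ≃ Y) : Prop :=
  ∀ x y, R x y ↔ S (φ x) (φ y)

/-- The bijection `R → S`, `(x, y) ↦ (φ x, φ y)`. -/
def Carries.graphEquiv {X Y : Type u} {R : Setoid X} {S : Setoid Y} {φ : X ≃ Y}
    (h : Carries R S φ) : Graph R ≃ Graph S :=
  (φ.prodCongr φ).subtypeEquiv fun p => h p.1 p.2

/-- The bijection `R → S` induced by the homeomorphism `φ : X → Y` is itself a homeomorphism for the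
inductive limit topologies, so that `φ` is an isomorphism of topological groupoids. -/
def IsTopIso {X Y : Type u} [TopologicalSpace X] [TopologicalSpace Y] {R : Setoid X} {S : Setoid Y}
    (𝓔 : Exhaustion R) (𝓕 : Exhaustion S) (φ : X ≃ₜ Y) (h : Carries R S φ.toEquiv) : Prop :=
  @IsHomeomorph _ _ 𝓔.limTopology 𝓕.limTopology h.graphEquiv

/-! ### Bratteli diagrams -/

/-- A Bratteli diagram: `V n` is the set of vertices of level `n`, and `E n` is the set of edges
from level `n` to level `n + 1`. Every vertex emits finitely many, but at least one, edges. -/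
structure BratteliDiagram where
  V : ℕ → Type u
  E : ℕ → Type u
  s : ∀ {n}, E n → V n
  r : ∀ {n}, E n → V (n + 1)
  finite_out : ∀ {n} (v : V n), {e : E n | s e = v}.Finite
  nonempty_out : ∀ {n} (v : V n), {e : E n | s e = v}.Nonempty

namespace BratteliDiagram

/-- Infinite paths starting at level `0`; `x n` is the edge from level `n` to level `n + 1`. -/
def Path (B : BratteliDiagram.{u}) : Type u :=
  {x : ∀ n, B.E n // ∀ n, B.r (x n) = B.s (x (n + 1))}

variable (B : BratteliDiagram.{u})

/-- The cylinder set of the first `n` edges of `x`. -/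
def cylinder (x : B.Path) (n : ℕ) : Set B.Path :=
  {y | ∀ k < n, y.1 k = x.1 k}

/-- The topology generated by the cylinder sets. -/
instance : TopologicalSpace B.Path :=
  TopologicalSpace.generateFrom {U | ∃ x n, U = B.cylinder x n}

/-- The relation of having the same edges from level `N` on. -/
def tailFrom (N : ℕ) : Setoid B.Path where
  r x y := ∀ n, N ≤ n → x.1 n = y.1 n
  iseqv :=
    { refl := fun _ _ _ => rfl
      symm := fun h n hn => (h n hn).symm
      trans := fun h h' n hn => (h n hn).trans (h' n hn) }

/-- The tail equivalence relation: having the same edges from some level on. -/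
def tail : Setoid B.Path where
  r x y := ∃ N, ∀ n, N ≤ n → x.1 n = y.1 n
  iseqv :=
    { refl := fun _ => ⟨0, fun _ _ => rfl⟩
      symm := fun ⟨N, h⟩ => ⟨N, fun n hn => (h n hn).symm⟩
      trans := fun ⟨N, h⟩ ⟨N', h'⟩ => ⟨max N N', fun n hn =>
        (h n (le_trans (le_max_left _ _) hn)).trans (h' n (le_trans (le_max_right _ _) hn))⟩ }

/-- The tail equivalence relation as the increasing union of the relations `tailFrom N`. -/
def tailExhaustion : Exhaustion B.tail where
  rel := B.tailFrom
  mono := fun _ _ hab _ _ h n hn => h n (le_trans hab hn)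
  union := fun _ _ => Iff.rfl

variable {A : Type v} [Group A]

/-- The ordered product of the labels of the first `n` edges of `x`. -/
def labelProd {B : BratteliDiagram.{u}} (f : ∀ n, B.E n → A) (x : B.Path) : ℕ → A
  | 0 => 1
  | n + 1 => labelProd f x n * f n (x.1 n)

/-- `c` is a quasi-product cocycle: for some labelling `f` of the edges, `c(x,y)` is the limit of
`f(x₁) ⋯ f(xₙ) f(yₙ)⁻¹ ⋯ f(y₁)⁻¹`. That sequence is eventually constant, so the limit, which
makes sense in any group, is its eventual value. -/
def IsQuasiProduct (c : Graph B.tail → A) : Prop :=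
  IsCocycle B.tail c ∧ ∃ f : ∀ n, B.E n → A, ∀ p : Graph B.tail,
    ∀ᶠ n in Filter.atTop, labelProd f p.1.1 n * (labelProd f p.1.2 n)⁻¹ = c p

end BratteliDiagram

end AFRel

/-!
By compactness a locally constant function on the closed graph of `R_n` is constant on the products
of two cells of some clopen partition of `X`, and such a partition can be refined to one that
permutes with `R_n`. Applied to a cocycle and to the indicator functions of `R_0, …, R_n` this gives
a refining sequence of partitions `K_n` such that a class of `R_n` meets a cell of `K_n` in at most
one point. The classes of `R_n ⊔ K_n` and of `R_n ⊔ K_{n+1}` are the vertices and the edges of a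
Bratteli diagram whose tail equivalence relation is `R`. Base points `ρ_n x` of the classes of `R_n`
write the cocycle as `g_n(x) g_n(y)⁻¹` on `R_n`, with `g_n(x) = c(x, ρ_n x)`, and the functions
`g_n⁻¹ g_{n+1}` are the labels of the edges.

An arbitrary continuous cocycle also has the form `g_n(x) g_n(y)⁻¹` on `R_n`, with `g_n` continuous.
The function `g_n⁻¹ g_{n+1}` is `R_n`-invariant, hence close to an `R_n`-invariant locally constant
function `u_n`; if it is close enough, the functions `u_0 ⋯ u_{n-1} g_n⁻¹` converge uniformly, and
their limit conjugates `c` into a cocycle with finitely many values on each `R_n`.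
-/

namespace AFRel

open Filter Topology

section ProfiniteSpaces

variable {X : Type*} [TopologicalSpace X]

theorem exists_discreteQuotient_forall_fiber [CompactSpace X] [T2Space X]
    [TotallyDisconnectedSpace X] {P : Set X → Prop} (hP : ∀ ⦃s t⦄, s ⊆ t → P t → P s)
    (h : ∀ x, ∃ U ∈ 𝓝 x, P U) : ∃ Q : DiscreteQuotient X, ∀ q, P (Q.proj ⁻¹' {q}) := by
  have hW (x : X) : ∃ W, IsClopen W ∧ x ∈ W ∧ P W := by
    obtain ⟨U, hU, hPU⟩ := h x
    obtain ⟨W, hW, hxW, hWU⟩ :=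
      compact_exists_isClopen_in_isOpen isOpen_interior (mem_interior_iff_mem_nhds.2 hU)
    exact ⟨W, hW, hxW, hP (hWU.trans interior_subset) hPU⟩
  choose W hW hxW hPW using hW
  obtain ⟨t, ht⟩ := CompactSpace.elim_nhds_subcover W fun x => (hW x).isOpen.mem_nhds (hxW x)
  refine ⟨t.inf fun x => DiscreteQuotient.ofIsClopen (hW x), fun q => ?_⟩
  obtain ⟨x, rfl⟩ := DiscreteQuotient.proj_surjective _ q
  obtain ⟨y, hyt, hxy⟩ := Set.mem_iUnion₂.1 (ht.symm ▸ Set.mem_univ x : x ∈ ⋃ y ∈ t, W y)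
  refine hP (fun z hz => ?_) (hPW y)
  exact ((Finset.inf_le hyt : _ ≤ DiscreteQuotient.ofIsClopen (hW y)) (Quotient.exact hz)).2 hxy

theorem exists_isLocallyConstant_forall [CompactSpace X] [T2Space X] [TotallyDisconnectedSpace X]
    {A : Type*} {P : X → A → Prop} (h : ∀ x, ∃ a, ∀ᶠ y in 𝓝 x, P y a) :
    ∃ k : X → A, IsLocallyConstant k ∧ ∀ x, P x (k x) := by
  obtain ⟨Q, hQ⟩ := exists_discreteQuotient_forall_fiber
    (P := fun s => ∃ a, ∀ y ∈ s, P y a) (fun s t hst ⟨a, ha⟩ => ⟨a, fun y hy => ha y (hst hy)⟩)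
    (fun x => let ⟨a, ha⟩ := h x; ⟨_, ha, a, fun _ hy => hy⟩)
  choose k hk using hQ
  exact ⟨k ∘ Q.proj, Q.proj_isLocallyConstant.comp k, fun x => hk _ x rfl⟩

theorem exists_continuous_section {Y : Type*} [TopologicalSpace Y] [CompactSpace Y] [T2Space Y]
    [TotallyDisconnectedSpace Y] {f : X → Y} (hf : IsLocalHomeomorph f)
    (hsurj : Function.Surjective f) : ∃ σ : Y → X, Continuous σ ∧ Function.RightInverse σ f := by
  obtain ⟨e, he, hmem⟩ := exists_isLocallyConstant_forall
    (A := {e : OpenPartialHomeomorph X Y // ⇑e = f}) (P := fun y e => y ∈ e.1.target) fun y => by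
      obtain ⟨x, rfl⟩ := hsurj y
      obtain ⟨e, hx, rfl⟩ := hf x
      exact ⟨⟨e, rfl⟩, e.open_target.mem_nhds (e.map_source hx)⟩
  refine ⟨fun y => (e y).1.symm y, continuous_iff_continuousAt.2 fun y => ?_, fun y => ?_⟩
  · refine ((e y).1.symm.continuousAt (hmem y)).congr ?_
    filter_upwards [(IsLocallyConstant.iff_eventually_eq e).1 he y] with z hz
    rw [hz]
  · calc f ((e y).1.symm y) = (e y).1 ((e y).1.symm y) := by rw [(e y).2]
      _ = y := (e y).1.right_inv (hmem y)

theorem isLocallyConstant_curry {Y D : Type*} [TopologicalSpace Y] [CompactSpace Y]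
    {f : X × Y → D} (hf : IsLocallyConstant f) : IsLocallyConstant fun x y => f (x, y) := by
  rw [IsLocallyConstant.iff_eventually_eq] at hf ⊢
  intro x
  have hcongr (y : Y) : ∀ᶠ z : X × Y in 𝓝 (x, y), f z = f (x, z.2) := by
    have hcont : ContinuousAt (fun z : X × Y => (x, z.2)) (x, y) := by fun_prop
    filter_upwards [hf (x, y), hcont.eventually (hf (x, y))] with z hz hxz using hz.trans hxz.symm
  filter_upwards [isCompact_univ.eventually_forall_of_forall_eventually
    (P := fun x' y => f (x', y) = f (x, y)) fun y _ => hcongr y] with x' hx'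
  exact funext fun y => hx' y trivial

theorem exists_discreteQuotient_forall_eq [CompactSpace X] {D : Type*} {f : X × X → D}
    (hf : IsLocallyConstant f) : ∃ L : DiscreteQuotient X, ∀ p q : X × X,
      L.toSetoid p.1 q.1 → L.toSetoid p.2 q.2 → f p = f q := by
  let L₁ := (⟨_, isLocallyConstant_curry hf⟩ : LocallyConstant X (X → D)).discreteQuotient
  let L₂ := (⟨_, isLocallyConstant_curry (hf.comp_continuous continuous_swap)⟩ :
    LocallyConstant X (X → D)).discreteQuotient
  exact ⟨L₁ ⊓ L₂, fun p q h₁ h₂ => (congrFun h₁.1 p.2).trans (congrFun h₂.2 q.1)⟩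

theorem exists_discreteQuotient_forall_eq_of_isClosed [CompactSpace X] [T2Space X]
    [TotallyDisconnectedSpace X] {Z : Set (X × X)} (hZ : IsClosed Z) {D : Type*} {d : Z → D}
    (hd : IsLocallyConstant d) :
    ∃ L : DiscreteQuotient X, ∀ p q : Z,
      L.toSetoid p.1.1 q.1.1 → L.toSetoid p.1.2 q.1.2 → d p = d q := by
  obtain ⟨Q, hQ⟩ := exists_discreteQuotient_forall_fiber
    (P := fun s => ∀ p q : Z, p.1 ∈ s → q.1 ∈ s → d p = d q)
    (fun s t hst ht p q hp hq => ht p q (hst hp) (hst hq)) fun x => by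
      by_cases hx : x ∈ Z
      · have h := (IsLocallyConstant.iff_eventually_eq d).1 hd ⟨x, hx⟩
        obtain ⟨U, hU, hUd⟩ := (mem_nhds_subtype _ _ _).1 h
        exact ⟨U, hU, fun p q hp hq => (hUd hp : d p = _).trans (hUd hq : d q = _).symm⟩
      · exact ⟨Zᶜ, hZ.isOpen_compl.mem_nhds hx, fun p _ hp => absurd p.2 hp⟩
  obtain ⟨L, hL⟩ := exists_discreteQuotient_forall_eq Q.proj_isLocallyConstant
  exact ⟨L, fun p q h₁ h₂ => hQ _ p q rfl (hL q.1 p.1 (L.toSetoid.symm h₁) (L.toSetoid.symm h₂))⟩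

theorem isLocallyConstant_of_forall_isClopen_mem {ι : Type*} [Finite ι] {τ : X → Set ι}
    (h : ∀ i, IsClopen {x | i ∈ τ x}) : IsLocallyConstant τ := by
  refine (IsLocallyConstant.iff_eventually_eq τ).2 fun x => ?_
  have hx (i : ι) : ∀ᶠ y in 𝓝 x, i ∈ τ y ↔ i ∈ τ x := by
    by_cases hi : i ∈ τ x
    · filter_upwards [(h i).isOpen.mem_nhds hi] with y hy using iff_of_true hy hi
    · filter_upwards [(h i).compl.isOpen.mem_nhds hi] with y hy using iff_of_false hy hi
  filter_upwards [eventually_all.2 hx] with y hy using Set.ext hy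

theorem exists_seq_discreteQuotient_separating (X : Type*) [TopologicalSpace X] [CompactSpace X]
    [T2Space X] [TotallyDisconnectedSpace X] [SecondCountableTopology X] :
    ∃ C : ℕ → DiscreteQuotient X, ∀ x y, (∀ n, (C n).toSetoid x y) → x = y := by
  have := TopologicalSpace.Clopens.countable_iff_secondCountable.2 ‹SecondCountableTopology X›
  obtain ⟨U, hU⟩ := exists_surjective_nat (TopologicalSpace.Clopens X)
  refine ⟨fun n => DiscreteQuotient.ofIsClopen (U n).isClopen, fun x y h => ?_⟩
  refine DiscreteQuotient.eq_of_forall_proj_eq fun Q => ?_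
  obtain ⟨n, hn⟩ := hU ⟨Q.proj ⁻¹' {Q.proj x}, Q.isClopen_preimage _⟩
  have hxy : x ∈ U n ↔ y ∈ U n := h n
  rw [hn] at hxy
  exact (hxy.1 rfl : Q.proj y = Q.proj x).symm

end ProfiniteSpaces

theorem exists_antitone_seq {ι : Type*} [Preorder ι] [Nonempty ι] {P : ℕ → ι → Prop}
    (h : ∀ n K, ∃ L ≤ K, P n L) : ∃ K : ℕ → ι, Antitone K ∧ ∀ n, P n (K n) := by
  choose g hle hP using h
  let K : ℕ → ι := Nat.rec (g 0 (Classical.arbitrary ι)) fun n K => g (n + 1) K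
  exact ⟨K, antitone_nat_of_succ_le fun n => hle _ _, fun n => by cases n <;> exact hP _ _⟩

section ProperRelations

variable {X : Type u} [TopologicalSpace X] {R S : Setoid X}

theorem IsProper.bot [T2Space X] : IsProper (⊥ : Setoid X) where
  isClosed_graph := isClosed_diagonal
  isLocalHomeomorph_mk := by
    have h : IsHomeomorph (Quotient.mk (⊥ : Setoid X)) :=
      isHomeomorph_iff_isQuotientMap_injective.2
        ⟨isQuotientMap_quotient_mk', fun _ _ hxy => Quotient.exact hxy⟩
    exact h.homeomorph.isLocalHomeomorph

theorem IsProper.t2Space_quotient (hR : IsProper R) : T2Space (Quotient R) := by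
  rw [t2Space_iff_of_isOpenQuotientMap ⟨Quotient.mk_surjective,
    hR.isLocalHomeomorph_mk.continuous, hR.isLocalHomeomorph_mk.isOpenMap⟩]
  simpa only [Quotient.eq] using hR.isClosed_graph

theorem IsProper.isClosedMap_mk [CompactSpace X] (hR : IsProper R) :
    IsClosedMap (Quotient.mk R) :=
  have := hR.t2Space_quotient
  hR.isLocalHomeomorph_mk.continuous.isClosedMap

theorem IsProper.isClopen_image_mk [CompactSpace X] (hR : IsProper R) {U : Set X}
    (hU : IsClopen U) : IsClopen (Quotient.mk R '' U) :=
  ⟨hR.isClosedMap_mk U hU.isClosed, hR.isLocalHomeomorph_mk.isOpenMap U hU.isOpen⟩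

theorem IsProper.isClopen_saturation [CompactSpace X] (hR : IsProper R) {U : Set X}
    (hU : IsClopen U) : IsClopen {x | ∃ y ∈ U, R x y} := by
  convert! (hR.isClopen_image_mk hU).preimage hR.isLocalHomeomorph_mk.continuous using 1
  ext x
  exact exists_congr fun y => and_congr_right fun _ => R.comm'.trans Quotient.eq.symm

theorem IsProper.totallyDisconnectedSpace_quotient [CompactSpace X] [T2Space X]
    [TotallyDisconnectedSpace X] (hR : IsProper R) : TotallyDisconnectedSpace (Quotient R) := by
  have := hR.t2Space_quotient
  have : TotallySeparatedSpace (Quotient R) := by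
    refine totallySeparatedSpace_iff_exists_isClopen.2 fun q q' hne => ?_
    obtain ⟨x, rfl⟩ := Quotient.mk_surjective q
    obtain ⟨W, hW, hxW, hWq'⟩ := compact_exists_isClopen_in_isOpen
      (isOpen_compl_singleton.preimage hR.isLocalHomeomorph_mk.continuous) hne
    refine ⟨_, hR.isClopen_image_mk hW, ⟨x, hxW, rfl⟩, ?_⟩
    rintro ⟨y, hyW, hy⟩
    exact hWq' hyW hy
  infer_instance

theorem IsProper.isClopen_graph_of_le (hR : IsProper R) (hS : IsProper S) (hSR : S ≤ R) :
    IsClopen {p : Graph R | S p.1.1 p.1.2} := by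
  refine ⟨hS.isClosed_graph.preimage continuous_subtype_val, isOpen_iff_mem_nhds.2 ?_⟩
  rintro ⟨⟨x, y⟩, -⟩ (hxy : S x y)
  obtain ⟨e, hy, he⟩ := hR.isLocalHomeomorph_mk y
  have hx : Quotient.mk S ⁻¹' (Quotient.mk S '' e.source) ∈ 𝓝 x :=
    ((hS.isLocalHomeomorph_mk.isOpenMap _ e.open_source).preimage
      hS.isLocalHomeomorph_mk.continuous).mem_nhds ⟨y, hy, Quotient.sound (S.symm hxy)⟩
  filter_upwards [continuous_subtype_val.continuousAt.preimage_mem_nhds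
    (prod_mem_nhds hx (e.open_source.mem_nhds hy))]
  rintro ⟨⟨x', y'⟩, hxy' : R x' y'⟩ ⟨⟨z, hz, hzx' : Quotient.mk S z = Quotient.mk S x'⟩, hy'⟩
  have hSzx' : S z x' := Quotient.exact hzx'
  obtain rfl : z = y' := e.injOn hz hy' <| by
    rw [← he]
    exact Quotient.sound (R.trans (hSR hSzx') hxy')
  exact S.symm hSzx'

end ProperRelations

namespace Exhaustion

variable {X Y : Type u} [TopologicalSpace X] [TopologicalSpace Y] {R : Setoid X} {S : Setoid Y}

theorem continuous_iff (𝓔 : Exhaustion R) {Z : Type*} {t : TopologicalSpace Z}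
    {f : Graph R → Z} : @Continuous _ _ 𝓔.limTopology t f ↔ ∀ n, Continuous (f ∘ 𝓔.incl n) := by
  simp only [continuous_iSup_dom, continuous_coinduced_dom]

theorem continuous_incl (𝓔 : Exhaustion R) (n : ℕ) :
    @Continuous _ _ _ 𝓔.limTopology (𝓔.incl n) :=
  𝓔.continuous_iff.1 (@continuous_id _ 𝓔.limTopology) n

theorem isLocallyConstant_iff (𝓔 : Exhaustion R) {Z : Type*} {f : Graph R → Z} :
    @IsLocallyConstant _ _ 𝓔.limTopology f ↔ ∀ n, IsLocallyConstant (f ∘ 𝓔.incl n) := by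
  let : TopologicalSpace Z := ⊥
  have : DiscreteTopology Z := ⟨rfl⟩
  let := 𝓔.limTopology
  simp only [IsLocallyConstant.iff_continuous]
  exact 𝓔.continuous_iff

theorem continuous_of_forall_exists (𝓔 : Exhaustion R) (𝓕 : Exhaustion S) {φ : X → Y}
    (hφ : Continuous φ) (h : ∀ n, ∃ m, ∀ x y, 𝓔.rel n x y → 𝓕.rel m (φ x) (φ y))
    {F : Graph R → Graph S} (hF : ∀ p, (F p).1 = (φ p.1.1, φ p.1.2)) :
    @Continuous _ _ 𝓔.limTopology 𝓕.limTopology F := by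
  let := 𝓕.limTopology
  refine 𝓔.continuous_iff.2 fun n => ?_
  obtain ⟨m, hm⟩ := h n
  let G : Graph (𝓔.rel n) → Graph (𝓕.rel m) := fun p => ⟨(φ p.1.1, φ p.1.2), hm _ _ p.2⟩
  have hG : Continuous G := by
    refine Continuous.subtype_mk ?_ _
    fun_prop
  have hcomm : F ∘ 𝓔.incl n = 𝓕.incl m ∘ G := funext fun p => Subtype.ext (hF _)
  rw [hcomm]
  exact (𝓕.continuous_incl m).comp hG

theorem limTopology_le_of_forall_exists (𝓔 𝓕 : Exhaustion R)
    (h : ∀ n, ∃ m, 𝓔.rel n ≤ 𝓕.rel m) : 𝓔.limTopology ≤ 𝓕.limTopology :=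
  continuous_id_iff_le.1 <| 𝓔.continuous_of_forall_exists 𝓕 continuous_id h fun _ => rfl

theorem exists_isTopIso_of_forall_rel_iff (𝓔 : Exhaustion R) (𝓕 : Exhaustion S) (φ : X ≃ₜ Y)
    (hφ : ∀ n x y, 𝓔.rel n x y ↔ 𝓕.rel n (φ x) (φ y)) :
    ∃ h : Carries R S φ.toEquiv, IsTopIso 𝓔 𝓕 φ h := by
  have h : Carries R S φ.toEquiv := fun x y =>
    (𝓔.union x y).trans ((exists_congr fun n => hφ n x y).trans (𝓕.union _ _).symm)
  let := 𝓔.limTopology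
  let := 𝓕.limTopology
  let e : Graph R ≃ₜ Graph S :=
    { h.graphEquiv with
      continuous_toFun := 𝓔.continuous_of_forall_exists 𝓕 φ.continuous
        (fun n => ⟨n, fun x y => (hφ n x y).1⟩) fun _ => rfl
      continuous_invFun := 𝓕.continuous_of_forall_exists 𝓔 φ.symm.continuous
        (fun n => ⟨n, fun x y hxy => (hφ n _ _).2 (by simpa using! hxy)⟩) fun _ => rfl }
  exact ⟨h, e.isHomeomorph⟩

/-- The exhaustion of `R` by the relations `⊥, R₀, R₁, …`. It is needed because the paths in a
Bratteli diagram that agree from level `0` on are equal. -/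
def withBot {X : Type u} {R : Setoid X} (𝓔 : Exhaustion R) : Exhaustion R where
  rel
    | 0 => ⊥
    | n + 1 => 𝓔.rel n
  mono := monotone_nat_of_le_succ fun
    | 0 => bot_le
    | n + 1 => 𝓔.mono n.le_succ
  union x y := (𝓔.union x y).trans
    ⟨fun ⟨n, h⟩ => ⟨n + 1, h⟩, fun
      | ⟨0, h⟩ => ⟨0, (bot_le : ⊥ ≤ 𝓔.rel 0) h⟩
      | ⟨n + 1, h⟩ => ⟨n, h⟩⟩

theorem limTopology_withBot (𝓔 : Exhaustion R) : 𝓔.withBot.limTopology = 𝓔.limTopology :=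
  le_antisymm
    (limTopology_le_of_forall_exists _ _ fun
      | 0 => ⟨0, bot_le⟩
      | n + 1 => ⟨n, le_rfl⟩)
    (limTopology_le_of_forall_exists _ _ fun n => ⟨n + 1, le_rfl⟩)

theorem IsAF.proper_withBot [T2Space X] {𝓔 : Exhaustion R} (h : 𝓔.IsAF) :
    ∀ n, IsProper (𝓔.withBot.rel n)
  | 0 => .bot
  | n + 1 => h.proper n

end Exhaustion

theorem isLocallyConstant_of_finite_range {X Y : Type*} [TopologicalSpace X] [TopologicalSpace Y]
    [T1Space Y] {f : X → Y} (hf : Continuous f) (hfin : (Set.range f).Finite) :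
    IsLocallyConstant f := by
  have := hfin.to_subtype
  exact ((IsLocallyConstant.iff_continuous _).2 hf.rangeFactorization).comp Subtype.val

theorem inv_mul_eq_inv_mul_of_mul_inv_eq_mul_inv {A : Type*} [Group A] {a b a' b' : A}
    (h : a * b⁻¹ = a' * b'⁻¹) : a⁻¹ * a' = b⁻¹ * b' := by
  rw [inv_mul_eq_iff_eq_mul, ← mul_assoc, h, inv_mul_cancel_right]

section Cocycles

variable {X : Type u} {R : Setoid X} {A : Type v} [Group A] {c : Graph R → A}

theorem IsCocycle.apply_eq_mul_inv (hc : IsCocycle R c) {ρ : X → X} (hρ : ∀ x, R x (ρ x))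
    {x y : X} (hxy : R x y) (h : ρ x = ρ y) :
    c ⟨(x, y), hxy⟩ = c ⟨(x, ρ x), hρ x⟩ * (c ⟨(y, ρ y), hρ y⟩)⁻¹ := by
  refine eq_mul_inv_of_mul_eq ((hc x y (ρ y) hxy (hρ y)).trans ?_)
  simp only [h]

variable [TopologicalSpace X] [TopologicalSpace A] {𝓔 : Exhaustion R}

theorem IsContCocycle.isLocallyConstant [T1Space A] (hc : IsContCocycle 𝓔 c)
    (hfin : FinitelyValuedOnEach 𝓔 c) : @IsLocallyConstant _ _ 𝓔.limTopology c :=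
  𝓔.isLocallyConstant_iff.2 fun n =>
    isLocallyConstant_of_finite_range (𝓔.continuous_iff.1 hc.continuous n) (hfin n)

theorem IsContCocycle.conj [IsTopologicalGroup A] (hc : IsContCocycle 𝓔 c) {b : X → A}
    (hb : Continuous b) : IsContCocycle 𝓔 fun p => b p.1.1 * c p * (b p.1.2)⁻¹ where
  cocycle x y z hxy hyz := by
    simp only [← hc.cocycle x y z hxy hyz]
    group
  continuous := 𝓔.continuous_iff.2 fun n => by
    have h := 𝓔.continuous_iff.1 hc.continuous n
    exact ((hb.comp (continuous_fst.comp continuous_subtype_val)).mul h).mul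
      (hb.comp (continuous_snd.comp continuous_subtype_val)).inv

end Cocycles

section FinitelyValuedReduction

variable {X : Type u} [TopologicalSpace X] [CompactSpace X] [T2Space X]
  [TotallyDisconnectedSpace X] {R : Setoid X} {𝓔 : Exhaustion R} {A : Type v}

theorem IsContCocycle.exists_incl_eq_mul_inv [Group A] [TopologicalSpace A] {c : Graph R → A}
    (hc : IsContCocycle 𝓔 c) {n : ℕ} (hR : IsProper (𝓔.rel n)) :
    ∃ g : X → A, Continuous g ∧ ∀ p, c (𝓔.incl n p) = g p.1.1 * (g p.1.2)⁻¹ := by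
  have := hR.t2Space_quotient
  have := hR.totallyDisconnectedSpace_quotient
  obtain ⟨σ, hσ, hσmk⟩ :=
    exists_continuous_section hR.isLocalHomeomorph_mk Quotient.mk_surjective
  let ρ (x : X) : X := σ (Quotient.mk _ x)
  have hρ (x : X) : 𝓔.rel n x (ρ x) := Quotient.exact (hσmk _).symm
  let γ (x : X) : Graph (𝓔.rel n) := ⟨(x, ρ x), hρ x⟩
  have hγ : Continuous γ :=
    (continuous_id.prodMk (hσ.comp hR.isLocalHomeomorph_mk.continuous)).subtype_mk _
  refine ⟨fun x => c (𝓔.incl n (γ x)), (𝓔.continuous_iff.1 hc.continuous n).comp hγ, ?_⟩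
  rintro ⟨⟨x, y⟩, hxy : 𝓔.rel n x y⟩
  exact hc.cocycle.apply_eq_mul_inv (fun x => (𝓔.union _ _).2 ⟨n, hρ x⟩) _
    (congrArg σ (Quotient.sound hxy))

theorem IsProper.exists_isLocallyConstant_forall (hR : IsProper R) {P : X → A → Prop}
    (h : ∀ x, ∃ a, ∀ y, R x y → ∀ᶠ z in 𝓝 y, P z a) :
    ∃ u : Quotient R → A, IsLocallyConstant u ∧ ∀ x, P x (u (Quotient.mk R x)) := by
  have := hR.t2Space_quotient
  have := hR.totallyDisconnectedSpace_quotient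
  obtain ⟨u, hu, hPu⟩ := AFRel.exists_isLocallyConstant_forall
    (P := fun q a => ∀ x ∈ Quotient.mk R ⁻¹' {q}, P x a) fun q => by
      obtain ⟨x, rfl⟩ := Quotient.mk_surjective q
      obtain ⟨a, ha⟩ := h x
      exact ⟨a, hR.isClosedMap_mk.eventually_nhds_fiber _
        fun y hy => ha y (R.symm (Quotient.exact hy))⟩
  exact ⟨u, hu, fun x => hPu _ x rfl⟩

variable [Group A]

theorem IsProper.exists_isLocallyConstant_dist_le (hR : IsProper R) [PseudoMetricSpace A]
    [IsTopologicalGroup A] {g g' k : X → A} (hg : Continuous g) (hg' : Continuous g')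
    (hinv : ∀ x y, R x y → (g x)⁻¹ * g' x = (g y)⁻¹ * g' y) (hk : Continuous k)
    {δ : ℝ} (hδ : 0 < δ) :
    ∃ u : Quotient R → A, IsLocallyConstant u ∧
      ∀ x, dist (k x * (g x)⁻¹) (k x * u (Quotient.mk R x) * (g' x)⁻¹) ≤ δ := by
  refine hR.exists_isLocallyConstant_forall
    (P := fun x a => dist (k x * (g x)⁻¹) (k x * a * (g' x)⁻¹) ≤ δ) fun x =>
      ⟨(g x)⁻¹ * g' x, fun y hxy => ?_⟩
  have hcont : Continuous fun z => dist (k z * (g z)⁻¹) (k z * ((g x)⁻¹ * g' x) * (g' z)⁻¹) := by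
    fun_prop
  refine ((hcont.tendsto y).eventually_lt_const ?_).mono fun z hz => hz.le
  have hy : k y * ((g x)⁻¹ * g' x) * (g' y)⁻¹ = k y * (g y)⁻¹ := by
    rw [hinv x y hxy]
    group
  rwa [hy, dist_self]

theorem exists_seq_isLocallyConstant_dist_le {S : ℕ → Setoid X} (hS : ∀ n, IsProper (S n))
    [PseudoMetricSpace A] [IsTopologicalGroup A] {g : ℕ → X → A} (hg : ∀ n, Continuous (g n))
    (hinv : ∀ n x y, S n x y → (g n x)⁻¹ * g (n + 1) x = (g n y)⁻¹ * g (n + 1) y) :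
    ∃ k : ℕ → X → A, (∀ n, IsLocallyConstant (k n)) ∧
      (∀ n x y, S n x y → k (n + 1) x * (k (n + 1) y)⁻¹ = k n x * (k n y)⁻¹) ∧
      ∀ n x, dist (k n x * (g n x)⁻¹) (k (n + 1) x * (g (n + 1) x)⁻¹) ≤ 1 / 2 / 2 ^ n := by
  have step (n : ℕ) (k : {k : X → A // IsLocallyConstant k}) :=
    (hS n).exists_isLocallyConstant_dist_le (hg n) (hg (n + 1)) (hinv n) k.2.continuous
      (show (0 : ℝ) < 1 / 2 / 2 ^ n by positivity)
  choose u hu hdist using step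
  let k : ℕ → {k : X → A // IsLocallyConstant k} := Nat.rec ⟨1, .one⟩ fun n k =>
    ⟨fun x => k.1 x * u n k (Quotient.mk _ x), k.2.mul ((hu n k).comp_continuous
      (hS n).isLocalHomeomorph_mk.continuous)⟩
  refine ⟨fun n => (k n).1, fun n => (k n).2, fun n x y hxy => ?_, fun n x => hdist n (k n) x⟩
  change (k n).1 x * u n (k n) (Quotient.mk _ x) * ((k n).1 y * u n (k n) (Quotient.mk _ y))⁻¹ = _
  rw [Quotient.sound hxy]
  group

theorem IsContCocycle.exists_finitelyValued [TopologicalSpace A] [IsTopologicalGroup A]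
    [TopologicalSpace.IsCompletelyMetrizableSpace A] (hR : ∀ n, IsProper (𝓔.rel n))
    {c : Graph R → A} (hc : IsContCocycle 𝓔 c) :
    ∃ c' : Graph R → A, IsContCocycle 𝓔 c' ∧ ContCohomologous c c' ∧
      FinitelyValuedOnEach 𝓔 c' := by
  let := TopologicalSpace.upgradeIsCompletelyMetrizable A
  choose g hg hcg using fun n => hc.exists_incl_eq_mul_inv (hR n)
  have hinv (n : ℕ) (x y : X) (hxy : 𝓔.rel n x y) :
      (g n x)⁻¹ * g (n + 1) x = (g n y)⁻¹ * g (n + 1) y :=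
    inv_mul_eq_inv_mul_of_mul_inv_eq_mul_inv <|
      (hcg n ⟨(x, y), hxy⟩).symm.trans (hcg (n + 1) ⟨(x, y), 𝓔.mono n.le_succ hxy⟩)
  obtain ⟨k, hk, hkR, hdist⟩ := exists_seq_isLocallyConstant_dist_le hR hg hinv
  let b (n : ℕ) : C(X, A) := ⟨fun x => k n x * (g n x)⁻¹, (hk n).continuous.mul (hg n).inv⟩
  obtain ⟨b', hb'⟩ := cauchySeq_tendsto_of_complete <| cauchySeq_of_le_geometric_two (f := b)
    fun n => (ContinuousMap.dist_le (by positivity)).2 (hdist n)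
  have hblim (x : X) : Tendsto (fun n => b n x) atTop (𝓝 (b' x)) :=
    ((continuous_eval_const x).tendsto b').comp hb'
  refine ⟨_, hc.conj b'.continuous, ⟨b', b'.continuous, fun _ => rfl⟩, fun N => ?_⟩
  have hconst (n : ℕ) (hn : N ≤ n) (p : Graph (𝓔.rel N)) :
      k n p.1.1 * (k n p.1.2)⁻¹ = k N p.1.1 * (k N p.1.2)⁻¹ := by
    induction n, hn using Nat.le_induction with
    | base => rfl
    | succ n hn ih => exact (hkR n _ _ (𝓔.mono hn p.2)).trans ih
  have hconj (p : Graph (𝓔.rel N)) :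
      b' p.1.1 * c (𝓔.incl N p) * (b' p.1.2)⁻¹ = k N p.1.1 * (k N p.1.2)⁻¹ := by
    refine tendsto_nhds_unique (((hblim _).mul tendsto_const_nhds).mul (hblim _).inv)
      (tendsto_const_nhds.congr' ?_)
    filter_upwards [eventually_ge_atTop N] with n hn
    have hc_eq : c (𝓔.incl N p) = g n p.1.1 * (g n p.1.2)⁻¹ := hcg n ⟨p.1, 𝓔.mono hn p.2⟩
    rw [hc_eq, ← hconst n hn p]
    simp only [b, ContinuousMap.coe_mk]
    group
  have hfin := (hk N).range_finite
  refine (hfin.image2 (fun a a' => a * a'⁻¹) hfin).subset (Set.range_subset_iff.2 fun p => ?_)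
  exact ⟨_, ⟨_, rfl⟩, _, ⟨_, rfl⟩, (hconj p).symm⟩

end FinitelyValuedReduction

theorem isCompletelyMetrizableSpace_of_locallyCompact (A : Type*) [Group A] [TopologicalSpace A]
    [IsTopologicalGroup A] [WeaklyLocallyCompactSpace A] [TopologicalSpace.MetrizableSpace A] :
    TopologicalSpace.IsCompletelyMetrizableSpace A := by
  let := IsTopologicalGroup.rightUniformSpace A
  have : IsRightUniformGroup A := ⟨rfl⟩
  have := IsRightUniformGroup.completeSpace_of_weaklyLocallyCompactSpace (G := A)
  have : (uniformity A).IsCountablyGenerated := by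
    rw [IsRightUniformGroup.uniformity_eq]
    infer_instance
  infer_instance

section AdaptedPartitions

variable {X : Type u}

/-- The equivalence relations `R` and `K` permute: their composites in the two orders agree. By
symmetry of `R` and `K` it is enough to ask for one inclusion between the composites. -/
def Permutes (R K : Setoid X) : Prop :=
  ∀ ⦃x y z⦄, K x y → R x z → ∃ w, R y w ∧ K z w

theorem Permutes.sup_apply {R K : Setoid X} (h : Permutes R K) {x y : X} :
    (R ⊔ K) x y ↔ ∃ z, R x z ∧ K z y := by
  let T : Setoid X :=
    { r := fun x y => ∃ z, R x z ∧ K z y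
      iseqv :=
        { refl := fun x => ⟨x, R.refl x, K.refl x⟩
          symm := fun ⟨_, hxz, hzy⟩ =>
            let ⟨w, hyw, hxw⟩ := h hzy (R.symm hxz)
            ⟨w, hyw, K.symm hxw⟩
          trans := fun ⟨_, hxz, hzy⟩ ⟨_, hyv, hvw⟩ =>
            let ⟨t, hzt, hvt⟩ := h (K.symm hzy) hyv
            ⟨t, R.trans hxz hzt, K.trans (K.symm hvt) hvw⟩ } }
  have hT : R ⊔ K ≤ T :=
    sup_le (fun {_ y} hxy => ⟨y, hxy, K.refl y⟩) fun {x _} hxy => ⟨x, R.refl x, hxy⟩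
  have hR : R ≤ R ⊔ K := le_sup_left
  have hK : K ≤ R ⊔ K := le_sup_right
  exact ⟨fun hxy => hT hxy, fun ⟨_, hxz, hzy⟩ => (R ⊔ K).trans (hR hxz) (hK hzy)⟩

variable [TopologicalSpace X] {R : Setoid X} {D : Type*}

/-- The partition `L` is adapted to `R` and to the function `d` on the graph of `R`: it permutes
with `R`, and `d` is constant on the trace on `R` of each product of two cells of `L`. -/
structure IsAdapted (R : Setoid X) (d : Graph R → D) (L : DiscreteQuotient X) : Prop where
  permutes : Permutes R L.toSetoid
  apply_eq : ∀ p q : Graph R, L.toSetoid p.1.1 q.1.1 → L.toSetoid p.1.2 q.1.2 → d p = d q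

variable [CompactSpace X] [T2Space X] [TotallyDisconnectedSpace X]

theorem IsProper.exists_isAdapted (hR : IsProper R) {d : Graph R → D} (hd : IsLocallyConstant d)
    (K : DiscreteQuotient X) : ∃ L ≤ K, IsAdapted R d L := by
  obtain ⟨L₀, hL₀⟩ := exists_discreteQuotient_forall_eq_of_isClosed hR.isClosed_graph hd
  let L := L₀ ⊓ K
  let τ (x : X) : Set L := L.proj '' {z | R x z}
  have hτ_inv {x y : X} (hxy : R x y) : τ x = τ y :=
    congrArg (L.proj '' ·) (Set.ext fun z => ⟨R.trans (R.symm hxy), R.trans hxy⟩)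
  have hτ : IsLocallyConstant τ := isLocallyConstant_of_forall_isClopen_mem fun i => by
    convert! hR.isClopen_saturation (L.isClopen_preimage {i}) using 1
    exact Set.ext fun x => exists_congr fun y => and_comm
  let M := L ⊓ (⟨τ, hτ⟩ : LocallyConstant X (Set L)).discreteQuotient
  refine ⟨M, inf_le_left.trans inf_le_right, fun x y z hxy hxz => ?_,
    fun p q h₁ h₂ => hL₀ p q h₁.1.1 h₂.1.1⟩
  have hz : L.proj z ∈ τ y := (show τ x = τ y from hxy.2) ▸ ⟨z, hxz, rfl⟩
  obtain ⟨w, hyw, hwz⟩ := hz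
  have hτzw : τ z = τ w := (hτ_inv hxz).symm.trans (hxy.2.trans (hτ_inv hyw))
  exact ⟨w, hyw, Quotient.exact hwz.symm, hτzw⟩

/-- A refining sequence of clopen partitions adapted to an exhaustion `R₀ ⊆ R₁ ⊆ ⋯`, from which a
Bratteli diagram is built: the vertices of level `n` are the classes of the join of `R_n` with the
`n`-th partition, and the edges from level `n` are those of its join with the next one. -/
structure AdaptedPartitions (𝓔 : Exhaustion R) where
  part : ℕ → DiscreteQuotient X
  antitone : Antitone part
  separating : ∀ x y, (∀ n, (part n).toSetoid x y) → x = y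
  permutes : ∀ {m n}, m ≤ n → Permutes (𝓔.rel m) (part n).toSetoid
  disjoint : ∀ {n x y}, 𝓔.rel n x y → (part n).toSetoid x y → x = y

/-- `c` is constant on the trace on `R_n` of each product of two cells of the `n`-th partition. -/
def AdaptedPartitions.Resolves {𝓔 : Exhaustion R} (𝓚 : AdaptedPartitions 𝓔) (c : Graph R → D) :
    Prop :=
  ∀ n, ∀ p q : Graph (𝓔.rel n), (𝓚.part n).toSetoid p.1.1 q.1.1 →
    (𝓚.part n).toSetoid p.1.2 q.1.2 → c (𝓔.incl n p) = c (𝓔.incl n q)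

theorem AdaptedPartitions.exists_resolves [SecondCountableTopology X] {𝓔 : Exhaustion R}
    (h𝓔 : ∀ n, IsProper (𝓔.rel n)) (h0 : 𝓔.rel 0 = ⊥) {c : Graph R → D}
    (hc : @IsLocallyConstant _ _ 𝓔.limTopology c) :
    ∃ 𝓚 : AdaptedPartitions 𝓔, 𝓚.Resolves c := by
  let d (n : ℕ) (p : Graph (𝓔.rel n)) : D × Set (Fin (n + 1)) :=
    (c (𝓔.incl n p), {m | 𝓔.rel m p.1.1 p.1.2})
  have hd (n : ℕ) : IsLocallyConstant (d n) :=
    (𝓔.isLocallyConstant_iff.1 hc n).prodMk <| isLocallyConstant_of_forall_isClopen_mem fun m =>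
      (h𝓔 n).isClopen_graph_of_le (h𝓔 m) (𝓔.mono m.is_le)
  obtain ⟨C, hC⟩ := exists_seq_discreteQuotient_separating X
  obtain ⟨K, hK, hKP⟩ := exists_antitone_seq
    (P := fun n L => L ≤ C n ∧ IsAdapted (𝓔.rel n) (d n) L) fun n K => by
      obtain ⟨L, hL, had⟩ := (h𝓔 n).exists_isAdapted (hd n) (K ⊓ C n)
      exact ⟨L, hL.trans inf_le_left, hL.trans inf_le_right, had⟩
  have hrel {m n : ℕ} (hmn : m ≤ n) (p q : Graph (𝓔.rel n))
      (h₁ : (K n).toSetoid p.1.1 q.1.1) (h₂ : (K n).toSetoid p.1.2 q.1.2)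
      (hp : 𝓔.rel m p.1.1 p.1.2) : 𝓔.rel m q.1.1 q.1.2 :=
    (Set.ext_iff.1 (congrArg Prod.snd ((hKP n).2.apply_eq p q h₁ h₂))
      ⟨m, Nat.lt_succ_of_le hmn⟩).1 hp
  exact
    ⟨{ part := K
       antitone := hK
       separating := fun x y h => hC x y fun n => (hKP n).1 (h n)
       permutes := fun {m n} hmn x y z hxy hxz => by
         obtain ⟨w, hyw, hzw⟩ := (hKP n).2.permutes hxy (𝓔.mono hmn hxz)
         exact ⟨w, hrel hmn ⟨(x, z), 𝓔.mono hmn hxz⟩ ⟨(y, w), hyw⟩ hxy hzw hxz, hzw⟩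
       disjoint := fun {n x y} hR hxy => by
         have h : 𝓔.rel 0 x y := hrel n.zero_le ⟨(x, x), (𝓔.rel n).refl x⟩ ⟨(x, y), hR⟩
           ((K n).toSetoid.refl x) hxy ((𝓔.rel 0).refl x)
         rwa [h0] at h },
      fun n p q h₁ h₂ => congrArg Prod.fst ((hKP n).2.apply_eq p q h₁ h₂)⟩

end AdaptedPartitions

instance (B : BratteliDiagram.{u}) : T2Space B.Path where
  t2 p q hpq := by
    obtain ⟨n, hn⟩ : ∃ n, p.1 n ≠ q.1 n := by
      by_contra! h
      exact hpq (Subtype.ext (funext h))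
    have hopen (x : B.Path) : IsOpen (B.cylinder x (n + 1)) :=
      TopologicalSpace.isOpen_generateFrom_of_mem ⟨x, n + 1, rfl⟩
    refine ⟨_, _, hopen p, hopen q, fun _ _ => rfl, fun _ _ => rfl, ?_⟩
    rw [Set.disjoint_left]
    exact fun z hz hz' => hn ((hz n n.lt_succ_self).symm.trans (hz' n n.lt_succ_self))

namespace AdaptedPartitions

variable {X : Type u} [TopologicalSpace X] {R : Setoid X} {𝓔 : Exhaustion R}
  (𝓚 : AdaptedPartitions 𝓔)

/-- The partition of `X` into the classes of the join of `R_m` and the `n`-th partition. The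
Bratteli diagram has the cells of `𝓚.join n n` as vertices and those of `𝓚.join n (n + 1)` as edges
from level `n`. -/
def join (m n : ℕ) : DiscreteQuotient X where
  toSetoid := 𝓔.rel m ⊔ (𝓚.part n).toSetoid
  isOpen_setOfPred_rel _ := isOpen_iff_mem_nhds.2 fun y hxy =>
    Filter.mem_of_superset (((𝓚.part n).isOpen_setOfPred_rel y).mem_nhds ((𝓚.part n).refl y))
      fun _ hyz => Setoid.trans' _ hxy ((le_sup_right : (𝓚.part n).toSetoid ≤ 𝓔.rel m ⊔ _) hyz)

theorem join_mono {m m' n n' : ℕ} (hm : m ≤ m') (hn : n' ≤ n) : 𝓚.join m n ≤ 𝓚.join m' n' :=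
  sup_le_sup (𝓔.mono hm) (𝓚.antitone hn)

theorem join_proj_eq_of_rel (n : ℕ) {m : ℕ} {x y : X} (h : 𝓔.rel m x y) :
    (𝓚.join m n).proj x = (𝓚.join m n).proj y :=
  Quotient.sound ((le_sup_left : 𝓔.rel m ≤ 𝓔.rel m ⊔ (𝓚.part n).toSetoid) h)

theorem join_proj_eq_of_part (m : ℕ) {n : ℕ} {x y : X} (h : (𝓚.part n).toSetoid x y) :
    (𝓚.join m n).proj x = (𝓚.join m n).proj y :=
  Quotient.sound ((le_sup_right : (𝓚.part n).toSetoid ≤ 𝓔.rel m ⊔ (𝓚.part n).toSetoid) h)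

theorem join_proj_eq_iff {m n : ℕ} (hmn : m ≤ n) {x y : X} :
    (𝓚.join m n).proj x = (𝓚.join m n).proj y ↔ ∃ z, 𝓔.rel m x z ∧ (𝓚.part n).toSetoid z y :=
  Quotient.eq.trans (𝓚.permutes hmn).sup_apply

/-- A choice of a base point `point n x` in each class of `R_n`, such that the base points of
classes that meet the same cell of the `n`-th partition lie in one cell of it. -/
structure BasePoints where
  point : ℕ → X → X
  rel_point : ∀ n x, 𝓔.rel n x (point n x)
  point_eq : ∀ {n x y}, 𝓔.rel n x y → point n x = point n y
  part_point : ∀ {n x y}, (𝓚.part n).toSetoid x y → (𝓚.part n).toSetoid (point n x) (point n y)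

instance : Nonempty 𝓚.BasePoints := by
  have hv (n : ℕ) (v : 𝓚.join n n) :
      ∃ b, ∀ x, (𝓚.join n n).proj x = v → ∃ x', 𝓔.rel n x x' ∧ (𝓚.part n).toSetoid x' b := by
    obtain ⟨b, rfl⟩ := (𝓚.join n n).proj_surjective v
    exact ⟨b, fun x => (𝓚.join_proj_eq_iff le_rfl).1⟩
  choose b hb using hv
  choose ρ hρ hρb using fun n x => hb n _ x rfl
  have hpart {n : ℕ} {x y : X} (h : (𝓚.join n n).proj x = (𝓚.join n n).proj y) :
      (𝓚.part n).toSetoid (ρ n x) (ρ n y) := by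
    have hx := hρb n x
    rw [h] at hx
    exact Setoid.trans' _ hx (Setoid.symm' _ (hρb n y))
  exact
    ⟨{ point := ρ
       rel_point := hρ
       point_eq := fun {n x y} hxy => by
         refine 𝓚.disjoint ?_ (hpart (𝓚.join_proj_eq_of_rel n hxy))
         exact Setoid.trans' _ (Setoid.symm' _ (hρ n x)) (Setoid.trans' _ hxy (hρ n y))
       part_point := fun {n _ _} hxy => hpart (𝓚.join_proj_eq_of_part n hxy) }⟩

variable [CompactSpace X]

/-- The Bratteli diagram of a sequence of adapted partitions; source and range of an edge are the
vertices that contain it as a subset of `X`. -/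
def diagram : BratteliDiagram.{u} where
  V n := 𝓚.join n n
  E n := 𝓚.join n (n + 1)
  s {n} := DiscreteQuotient.ofLE (𝓚.join_mono le_rfl n.le_succ)
  r {n} := DiscreteQuotient.ofLE (𝓚.join_mono n.le_succ le_rfl)
  finite_out _ := Set.toFinite _
  nonempty_out {n} v := by
    obtain ⟨x, rfl⟩ := (𝓚.join n n).proj_surjective v
    exact ⟨(𝓚.join n (n + 1)).proj x, rfl⟩

/-- The path of `x`: its `n`-th edge is the one that contains `x`. -/
def pathOf (x : X) : 𝓚.diagram.Path :=
  ⟨fun n => (𝓚.join n (n + 1)).proj x, fun _ => rfl⟩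

theorem continuous_pathOf : Continuous 𝓚.pathOf := by
  refine continuous_generateFrom_iff.2 ?_
  rintro _ ⟨p, n, rfl⟩
  have hpre : 𝓚.pathOf ⁻¹' 𝓚.diagram.cylinder p n =
      ⋂ k ∈ Set.Iio n, (𝓚.join k (k + 1)).proj ⁻¹' {p.1 k} := by
    ext x
    simp only [Set.mem_iInter]
    rfl
  rw [hpre]
  exact (Set.finite_Iio n).isOpen_biInter fun k _ => (𝓚.join k (k + 1)).isOpen_preimage _

theorem exists_rel_forall_lt (p : 𝓚.diagram.Path) (n : ℕ) {y : X}
    (hy : (𝓚.join n n).proj y = 𝓚.diagram.s (p.1 n)) :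
    ∃ x, 𝓔.rel n y x ∧ ∀ k < n, (𝓚.join k (k + 1)).proj x = p.1 k := by
  induction n generalizing y with
  | zero => exact ⟨y, (𝓔.rel 0).refl y, fun k hk => absurd hk k.not_lt_zero⟩
  | succ n ih =>
    obtain ⟨z, hz⟩ := (𝓚.join n (n + 1)).proj_surjective (p.1 n)
    have hyz : (𝓚.join (n + 1) (n + 1)).proj y = (𝓚.join (n + 1) (n + 1)).proj z := by
      rw [hy, ← p.2 n, ← hz]
      rfl
    obtain ⟨y', hyy', hy'z⟩ := (𝓚.join_proj_eq_iff le_rfl).1 hyz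
    have hy' : (𝓚.join n (n + 1)).proj y' = p.1 n := (𝓚.join_proj_eq_of_part _ hy'z).trans hz
    obtain ⟨x, hy'x, hx⟩ := ih (congrArg 𝓚.diagram.s hy')
    refine ⟨x, (𝓔.rel (n + 1)).trans hyy' (𝓔.mono n.le_succ hy'x), fun k hk => ?_⟩
    obtain hk | rfl := Nat.lt_succ_iff_lt_or_eq.1 hk
    · exact hx k hk
    · exact (𝓚.join_proj_eq_of_rel _ hy'x).symm.trans hy'

theorem pathOf_surjective : Function.Surjective 𝓚.pathOf := by
  intro p
  let S (n : ℕ) : Set X := ⋂ k ∈ Set.Iio n, (𝓚.join k (k + 1)).proj ⁻¹' {p.1 k}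
  have hclosed (n : ℕ) : IsClosed (S n) :=
    isClosed_biInter fun k _ => (𝓚.join k (k + 1)).isClosed_preimage _
  have hnonempty (n : ℕ) : (S n).Nonempty := by
    obtain ⟨y, hy⟩ := (𝓚.join n n).proj_surjective (𝓚.diagram.s (p.1 n))
    obtain ⟨x, -, hx⟩ := 𝓚.exists_rel_forall_lt p n hy
    exact ⟨x, Set.mem_iInter₂.2 hx⟩
  obtain ⟨x, hx⟩ := IsCompact.nonempty_iInter_of_sequence_nonempty_isCompact_isClosed S
    (fun n => Set.biInter_subset_biInter_left (Set.Iio_subset_Iio n.le_succ)) hnonempty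
    (hclosed 0).isCompact hclosed
  exact ⟨x, Subtype.ext <| funext fun k =>
    Set.mem_iInter₂.1 (Set.mem_iInter.1 hx (k + 1)) k k.lt_succ_self⟩

theorem rel_iff_tailFrom_pathOf (N : ℕ) (x y : X) :
    𝓔.rel N x y ↔ 𝓚.diagram.tailFrom N (𝓚.pathOf x) (𝓚.pathOf y) := by
  refine ⟨fun hxy n hn => 𝓚.join_proj_eq_of_rel _ (𝓔.mono hn hxy), fun hxy => ?_⟩
  obtain ⟨x', hxx', hx'y⟩ := (𝓚.join_proj_eq_iff (Nat.le_succ _)).1 (hxy N le_rfl)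
  have hpart (n : ℕ) (hn : N ≤ n) : (𝓚.part (n + 1)).toSetoid x' y := by
    induction n, hn using Nat.le_induction with
    | base => exact hx'y
    | succ n hn ih =>
      have hedge : (𝓚.join (n + 1) (n + 2)).proj x' = (𝓚.join (n + 1) (n + 2)).proj y :=
        (𝓚.join_proj_eq_of_rel _ (𝓔.mono (Nat.le_succ_of_le hn) hxx')).symm.trans
          (hxy (n + 1) (Nat.le_succ_of_le hn))
      obtain ⟨w, hx'w, hwy⟩ := (𝓚.join_proj_eq_iff (Nat.le_succ _)).1 hedge
      have hx'w_part : (𝓚.part (n + 1)).toSetoid x' w :=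
        Setoid.trans' _ ih (Setoid.symm' _ (𝓚.antitone (n + 1).le_succ hwy))
      rwa [𝓚.disjoint hx'w hx'w_part]
  obtain rfl : x' = y := 𝓚.separating _ _ fun n =>
    𝓚.antitone (by omega) (hpart (max N n) (le_max_left _ _))
  exact hxx'

theorem pathOf_injective (h0 : 𝓔.rel 0 = ⊥) : Function.Injective 𝓚.pathOf := fun x y hxy => by
  have h : 𝓔.rel 0 x y :=
    (𝓚.rel_iff_tailFrom_pathOf 0 x y).2 (hxy ▸ (𝓚.diagram.tailFrom 0).refl _)
  rwa [h0] at h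

/-- The identification of `X` with the path space, given by `x ↦ 𝓚.pathOf x`. -/
noncomputable def pathHomeomorph (h0 : 𝓔.rel 0 = ⊥) : X ≃ₜ 𝓚.diagram.Path :=
  𝓚.continuous_pathOf.homeoOfEquivCompactToT2
    (f := .ofBijective 𝓚.pathOf ⟨𝓚.pathOf_injective h0, 𝓚.pathOf_surjective⟩)

end AdaptedPartitions

namespace AdaptedPartitions.BasePoints

variable {X : Type u} [TopologicalSpace X] {R : Setoid X} {𝓔 : Exhaustion R}
  {𝓚 : AdaptedPartitions 𝓔} (ρ : 𝓚.BasePoints) {A : Type v} {c : Graph R → A}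

/-- The function `x ↦ c (x, ρ_n x)`, which trivializes a cocycle `c` on `R_n`. -/
def trivialization (c : Graph R → A) (n : ℕ) (x : X) : A :=
  c (𝓔.incl n ⟨(x, ρ.point n x), ρ.rel_point n x⟩)

theorem trivialization_eq_of_part (hc : 𝓚.Resolves c) {n : ℕ} {x y : X}
    (hxy : (𝓚.part n).toSetoid x y) : ρ.trivialization c n x = ρ.trivialization c n y :=
  hc n _ _ hxy (ρ.part_point hxy)

variable [Group A]

theorem incl_eq_trivialization_mul_inv (hc : IsCocycle R c) {n : ℕ} (p : Graph (𝓔.rel n)) :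
    c (𝓔.incl n p) = ρ.trivialization c n p.1.1 * (ρ.trivialization c n p.1.2)⁻¹ :=
  hc.apply_eq_mul_inv (fun x => (𝓔.union _ _).2 ⟨n, ρ.rel_point n x⟩) _ (ρ.point_eq p.2)

theorem trivialization_zero (h0 : 𝓔.rel 0 = ⊥) (hc : IsCocycle R c) (x : X) :
    ρ.trivialization c 0 x = 1 := by
  have h : 𝓔.rel 0 x (ρ.point 0 x) := ρ.rel_point 0 x
  have hx : x = ρ.point 0 x := by rwa [h0] at h
  have hxx : c ⟨(x, x), R.refl x⟩ = 1 := mul_eq_left.1 (hc x x x (R.refl x) (R.refl x))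
  simpa only [trivialization, Exhaustion.incl, ← hx] using hxx

variable [CompactSpace X]

theorem exists_label (hc : IsCocycle R c) (hres : 𝓚.Resolves c) :
    ∃ f : ∀ n, 𝓚.diagram.E n → A, ∀ n x,
      f n ((𝓚.pathOf x).1 n) = (ρ.trivialization c n x)⁻¹ * ρ.trivialization c (n + 1) x := by
  refine ⟨fun n => Quotient.lift (s := (𝓚.join n (n + 1)).toSetoid)
    (fun x => (ρ.trivialization c n x)⁻¹ * ρ.trivialization c (n + 1) x) fun x y hxy => ?_,
    fun n x => rfl⟩
  obtain ⟨z, hxz, hzy⟩ := (𝓚.permutes n.le_succ).sup_apply.1 hxy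
  rw [← ρ.trivialization_eq_of_part hres hzy,
    ← ρ.trivialization_eq_of_part hres (𝓚.antitone n.le_succ hzy)]
  refine inv_mul_eq_inv_mul_of_mul_inv_eq_mul_inv ?_
  exact (ρ.incl_eq_trivialization_mul_inv hc ⟨(x, z), hxz⟩).symm.trans
    (ρ.incl_eq_trivialization_mul_inv hc ⟨(x, z), 𝓔.mono n.le_succ hxz⟩)

theorem labelProd_pathOf (h0 : 𝓔.rel 0 = ⊥) (hc : IsCocycle R c) {f : ∀ n, 𝓚.diagram.E n → A}
    (hf : ∀ n x,
      f n ((𝓚.pathOf x).1 n) = (ρ.trivialization c n x)⁻¹ * ρ.trivialization c (n + 1) x)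
    (x : X) (n : ℕ) :
    BratteliDiagram.labelProd f (𝓚.pathOf x) n = ρ.trivialization c n x := by
  induction n with
  | zero => exact (ρ.trivialization_zero h0 hc x).symm
  | succ n ih => rw [BratteliDiagram.labelProd, ih, hf, mul_inv_cancel_left]

end AdaptedPartitions.BasePoints

section QuasiProduct

variable {X : Type u} [TopologicalSpace X] [CompactSpace X] {R : Setoid X} {𝓔 : Exhaustion R}
  {A : Type v} [Group A] {c : Graph R → A}

theorem AdaptedPartitions.isQuasiProduct (𝓚 : AdaptedPartitions 𝓔) (h0 : 𝓔.rel 0 = ⊥)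
    (hc : IsCocycle R c) (hres : 𝓚.Resolves c)
    (h : Carries R 𝓚.diagram.tail (𝓚.pathHomeomorph h0).toEquiv) :
    𝓚.diagram.IsQuasiProduct (c ∘ h.graphEquiv.symm) := by
  obtain ⟨ρ⟩ : Nonempty 𝓚.BasePoints := inferInstance
  obtain ⟨f, hf⟩ := ρ.exists_label hc hres
  refine ⟨fun x y z hxy hyz => hc _ _ _ _ _, f, fun q => ?_⟩
  obtain ⟨⟨⟨x, y⟩, hxy⟩, rfl⟩ := h.graphEquiv.surjective q
  obtain ⟨N, hN⟩ := (𝓔.union x y).1 hxy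
  filter_upwards [eventually_ge_atTop N] with n hn
  have hlabel := ρ.labelProd_pathOf h0 hc hf
  rw [Function.comp_apply, Equiv.symm_apply_apply]
  exact (congrArg₂ (fun a b => a * b⁻¹) (hlabel x n) (hlabel y n)).trans
    (ρ.incl_eq_trivialization_mul_inv hc ⟨(x, y), 𝓔.mono hn hN⟩).symm

theorem Exhaustion.IsAF.exists_isTopIso_isQuasiProduct [T2Space X] [SecondCountableTopology X]
    (h𝓔 : 𝓔.IsAF) (hc : IsCocycle R c) (hlc : @IsLocallyConstant _ _ 𝓔.limTopology c) :
    ∃ (B : BratteliDiagram.{u}) (φ : X ≃ₜ B.Path) (h : Carries R B.tail φ.toEquiv),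
      IsTopIso 𝓔 B.tailExhaustion φ h ∧ B.IsQuasiProduct (c ∘ h.graphEquiv.symm) := by
  have := h𝓔.totallyDisconnected
  rw [← 𝓔.limTopology_withBot] at hlc
  obtain ⟨𝓚, h𝓚⟩ := AdaptedPartitions.exists_resolves h𝓔.proper_withBot rfl hlc
  obtain ⟨h, hiso⟩ := 𝓔.withBot.exists_isTopIso_of_forall_rel_iff 𝓚.diagram.tailExhaustion
    (𝓚.pathHomeomorph rfl) 𝓚.rel_iff_tailFrom_pathOf
  refine ⟨𝓚.diagram, 𝓚.pathHomeomorph rfl, h, ?_, 𝓚.isQuasiProduct rfl hc h𝓚 h⟩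
  unfold IsTopIso at hiso ⊢
  rwa [limTopology_withBot] at hiso

end QuasiProduct

end AFRel

theorem theorem3p1_general {X : Type u} [TopologicalSpace X] [CompactSpace X] [T2Space X]
    [SecondCountableTopology X] (R : Setoid X) (𝓔 : AFRel.Exhaustion R) (hAF : 𝓔.IsAF)
    (A : Type v) [Group A] [TopologicalSpace A] [IsTopologicalGroup A] [T1Space A] :
    (∃ (B : AFRel.BratteliDiagram.{u}) (φ : X ≃ₜ B.Path)
        (h : AFRel.Carries R B.tail φ.toEquiv),
        AFRel.IsTopIso 𝓔 B.tailExhaustion φ h) ∧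
    (∀ c : AFRel.Graph R → A, AFRel.IsContCocycle 𝓔 c → AFRel.FinitelyValuedOnEach 𝓔 c →
      ∃ (B : AFRel.BratteliDiagram.{u}) (φ : X ≃ₜ B.Path)
        (h : AFRel.Carries R B.tail φ.toEquiv),
        AFRel.IsTopIso 𝓔 B.tailExhaustion φ h ∧
          B.IsQuasiProduct (c ∘ h.graphEquiv.symm)) ∧
    (TopologicalSpace.IsCompletelyMetrizableSpace A →
      ∀ c : AFRel.Graph R → A, AFRel.IsContCocycle 𝓔 c →
        ∃ c' : AFRel.Graph R → A, AFRel.IsContCocycle 𝓔 c' ∧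
          AFRel.ContCohomologous c c' ∧ AFRel.FinitelyValuedOnEach 𝓔 c') ∧
    (TopologicalSpace.IsCompletelyMetrizableSpace A →
      ∀ c : AFRel.Graph R → A, AFRel.IsContCocycle 𝓔 c →
        ∃ c' : AFRel.Graph R → A, AFRel.IsContCocycle 𝓔 c' ∧ AFRel.ContCohomologous c c' ∧
          ∃ (B : AFRel.BratteliDiagram.{u}) (φ : X ≃ₜ B.Path)
            (h : AFRel.Carries R B.tail φ.toEquiv),
            AFRel.IsTopIso 𝓔 B.tailExhaustion φ h ∧
              B.IsQuasiProduct (c' ∘ h.graphEquiv.symm)) := by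
  have := hAF.totallyDisconnected
  have quasiProduct (c : AFRel.Graph R → A) (hc : AFRel.IsContCocycle 𝓔 c)
      (hfin : AFRel.FinitelyValuedOnEach 𝓔 c) :=
    hAF.exists_isTopIso_isQuasiProduct hc.cocycle (hc.isLocallyConstant hfin)
  refine ⟨?_, quasiProduct, fun hA c hc => hc.exists_finitelyValued hAF.proper,
    fun hA c hc => ?_⟩
  · have hone : AFRel.IsCocycle R (1 : AFRel.Graph R → A) := fun _ _ _ _ _ => one_mul 1
    obtain ⟨B, φ, h, hiso, -⟩ := hAF.exists_isTopIso_isQuasiProduct hone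
      (@IsLocallyConstant.const _ _ 𝓔.limTopology 1)
    exact ⟨B, φ, h, hiso⟩
  · obtain ⟨c', hc', hcc', hfin⟩ := hc.exists_finitelyValued hAF.proper
    exact ⟨c', hc', hcc', quasiProduct c' hc' hfin⟩

theorem theorem3p1 {X : Type u} [TopologicalSpace X] [CompactSpace X] [T2Space X]
    [SecondCountableTopology X] (R : Setoid X) (𝓔 : AFRel.Exhaustion R) (hAF : 𝓔.IsAF)
    (A : Type v) [Group A] [TopologicalSpace A] [IsTopologicalGroup A] [T2Space A]
    [LocallyCompactSpace A] :
    -- (1) `(X, R)` is isomorphic to a tail equivalence relation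
    (∃ (B : AFRel.BratteliDiagram.{u}) (φ : X ≃ₜ B.Path)
        (h : AFRel.Carries R B.tail φ.toEquiv),
        AFRel.IsTopIso 𝓔 B.tailExhaustion φ h) ∧
    -- (2) cocycles with finitely many values on each `R_n`
    (∀ c : AFRel.Graph R → A, AFRel.IsContCocycle 𝓔 c → AFRel.FinitelyValuedOnEach 𝓔 c →
      ∃ (B : AFRel.BratteliDiagram.{u}) (φ : X ≃ₜ B.Path)
        (h : AFRel.Carries R B.tail φ.toEquiv),
        AFRel.IsTopIso 𝓔 B.tailExhaustion φ h ∧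
          B.IsQuasiProduct (c ∘ h.graphEquiv.symm)) ∧
    -- (3) reduction of an arbitrary continuous cocycle
    (TopologicalSpace.MetrizableSpace A →
      ∀ c : AFRel.Graph R → A, AFRel.IsContCocycle 𝓔 c →
        ∃ c' : AFRel.Graph R → A, AFRel.IsContCocycle 𝓔 c' ∧
          AFRel.ContCohomologous c c' ∧ AFRel.FinitelyValuedOnEach 𝓔 c') ∧
    -- (4) every continuous cocycle is cohomologous to a quasi-product cocycle
    (TopologicalSpace.MetrizableSpace A →
      ∀ c : AFRel.Graph R → A, AFRel.IsContCocycle 𝓔 c →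
        ∃ c' : AFRel.Graph R → A, AFRel.IsContCocycle 𝓔 c' ∧ AFRel.ContCohomologous c c' ∧
          ∃ (B : AFRel.BratteliDiagram.{u}) (φ : X ≃ₜ B.Path)
            (h : AFRel.Carries R B.tail φ.toEquiv),
            AFRel.IsTopIso 𝓔 B.tailExhaustion φ h ∧
              B.IsQuasiProduct (c' ∘ h.graphEquiv.symm)) := by
  obtain ⟨h₁, h₂, h₃, h₄⟩ := theorem3p1_general R 𝓔 hAF A
  have complete (_ : TopologicalSpace.MetrizableSpace A) :=
    AFRel.isCompletelyMetrizableSpace_of_locallyCompact A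
  exact ⟨h₁, h₂, h₃ ∘ complete, h₄ ∘ complete⟩
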